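/- Let $k$ be a field and $\Lambda$ a finite dimensional associative unital $k$-algebra. Bimodules over $\Lambda$ (with $k$ acting centrally) are regarded as left modules over $\Lambda^e=\Lambda\otimes_k\Lambda^{\mathrm{op}}$ via $(a\otimes b)x=axb$, or as right $\Lambda^e$-modules via $x(a\otimes b)=bxa$. Write $D=\operatorname{Hom}_k(-,k)$. For a finitely generated left $\Lambda^e$-module $M$, let $\Omega M$ be the kernel of a projective cover $P(M)\to M$, let $\operatorname{Tr}M$ be the cokernel of the map of right $\Lambda^e$-modules $\operatorname{Hom}_{\Lambda^e}(P(M),\Lambda^e)\to\operatorname{Hom}_{\Lambda^e}(P(\Omega M),\Lambda^e)$ induced by $P(\Omega M)\to\Omega M\subseteq P(M)$, and let $\tau M=D\operatorname{Tr}M$. For $n\ge 1$ put $\tau_n\Lambda=\tau\Omega^{n-1}\Lambda$ and, for a finite dimensional $\Lambda$-bimodule $X$, $$\mathrm{HH}^n_\tau(\Lambda,X)=D\operatorname{Hom}_{\Lambda^e}(X,\tau_n\Lambda),\qquad \mathrm{HH}_n^\tau(\Lambda,X)=\operatorname{Hom}_{\Lambda^e}(DX,\tau_n\Lambda).$$ Let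 $\cdots\to P_n\xrightarrow{d_n}P_{n-1}\to\cdots\to P_1\xrightarrow{d_1}P_0\to\Lambda\to 0$ be a minimal projective resolution of the $\Lambda$-bimodule $\Lambda$ by finitely generated bimodules, and let $$\delta_n=\operatorname{Hom}_{\Lambda^e}(d_n,X):\operatorname{Hom}_{\Lambda^e}(P_{n-1},X)\to\operatorname{Hom}_{\Lambda^e}(P_n,X),\qquad \delta'_n=X\otimes_{\Lambda^e}d_n:X\otimes_{\Lambda^e}P_n\to X\otimes_{\Lambda^e}P_{n-1}.$$ Theorem. For every $n\ge 1$ there are isomorphisms of $k$-vector spaces, natural in the finite dimensional $\Lambda$-bimodule $X$, $$\mathrm{HH}^n_\tau(\Lambda,X)\cong\operatorname{Coker}\delta_n,\qquad \mathrm{HH}_n^\tau(\Lambda,X)\cong\operatorname{Ker}\delta'_n.$$ -/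

import Mathlib

open scoped TensorProduct
open MulOpposite

noncomputable section

namespace TauHochschild

/-! ### Projective covers, syzygies and the transpose over a left Artinian ring -/

section Covers

/-- A submodule `K` of `P` is superfluous if `N + K = P` forces `N = P`. -/
def IsSuperfluous {A P : Type*} [Ring A] [AddCommGroup P] [Module A P]
    (K : Submodule A P) : Prop :=
  ∀ N : Submodule A P, N ⊔ K = ⊤ → N = ⊤

/-- A projective cover: a surjection from a projective module, with superfluous kernel. -/
structure IsProjectiveCover {A P M : Type*} [Ring A] [AddCommGroup P] [Module A P]
    [AddCommGroup M] [Module A M] (f : P →ₗ[A] M) : Prop where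
  projective : Module.Projective A P
  surjective : Function.Surjective f
  superfluous : IsSuperfluous (LinearMap.ker f)

/-- Every finitely generated module over a left Artinian ring has a projective cover,
which can be found inside a finite free module. -/
theorem exists_projectiveCover (A M : Type*) [Ring A] [IsArtinianRing A]
    [AddCommGroup M] [Module A M] [Module.Finite A M] :
    ∃ (n : ℕ) (Q : Submodule A (Fin n → A)) (f : Q →ₗ[A] M), IsProjectiveCover f := by
  obtain ⟨n, g, hg⟩ := Module.Finite.exists_fin' A M
  refine ⟨n, ?_⟩
  let S : Set (Submodule A (Fin n → A)) :=
    {Q | Module.Projective A Q ∧ Function.Surjective (g.domRestrict Q)}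
  have hS : S.Nonempty := by
    refine ⟨⊤, Module.Projective.of_equiv (Submodule.topEquiv (R := A)).symm, fun m => ?_⟩
    obtain ⟨x, rfl⟩ := hg m
    exact ⟨⟨x, trivial⟩, rfl⟩
  obtain ⟨Q, ⟨hQ, hQs⟩, hmin⟩ :=
    WellFounded.has_min (wellFounded_lt (α := Submodule A (Fin n → A))) S hS
  refine ⟨Q, g.domRestrict Q, hQ, hQs, fun N hN => ?_⟩
  have hN' : Function.Surjective ((g.domRestrict Q).domRestrict N) := by
    intro m
    obtain ⟨q, rfl⟩ := hQs m
    have : q ∈ N ⊔ LinearMap.ker (g.domRestrict Q) := hN ▸ trivial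
    obtain ⟨x, hx, y, hy, rfl⟩ := Submodule.mem_sup.1 this
    exact ⟨⟨x, hx⟩, by rw [map_add, LinearMap.mem_ker.1 hy, add_zero]; rfl⟩
  obtain ⟨l, hl⟩ := Module.projective_lifting_property _ (g.domRestrict Q) hN'
  let h : Module.End A Q := N.subtype ∘ₗ l
  have hgh : ∀ q, g.domRestrict Q (h q) = g.domRestrict Q q := fun q =>
    LinearMap.congr_fun hl q
  have hghp : ∀ (m : ℕ) q, g.domRestrict Q ((h ^ m) q) = g.domRestrict Q q := by
    intro m
    induction m with
    | zero => intro q; rfl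
    | succ m ih => intro q; rw [pow_succ, Module.End.mul_apply, ih, hgh]
  obtain ⟨m, hm, hm1⟩ :=
    ((LinearMap.eventually_isCompl_ker_pow_range_pow h).and
      (Filter.eventually_ge_atTop 1)).exists
  let R := LinearMap.range (h ^ m)
  have hRp : Module.Projective A R := by
    refine Module.Projective.of_split R.subtype (Submodule.projectionOnto _ _ hm.symm) ?_
    exact LinearMap.ext fun x => Submodule.projectionOnto_apply_left hm.symm x
  let Q' : Submodule A (Fin n → A) := R.map Q.subtype
  have hQ' : Q' ∈ S := by
    have e : R ≃ₗ[A] Q' := Submodule.equivMapOfInjective _ Q.injective_subtype R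
    refine ⟨Module.Projective.of_equiv e, fun y => ?_⟩
    obtain ⟨q, rfl⟩ := hQs y
    exact ⟨⟨_, Submodule.mem_map_of_mem (f := Q.subtype) (LinearMap.mem_range_self (h ^ m) q)⟩,
      hghp m q⟩
  have hle : Q' ≤ Q := Submodule.map_subtype_le _ _
  have hQQ : Q' = Q := by
    by_contra hne
    exact hmin Q' hQ' (lt_of_le_of_ne hle hne)
  rw [eq_top_iff]
  rintro ⟨q, hq⟩ -
  obtain ⟨r, ⟨s, rfl⟩, hr⟩ := (hQQ ▸ hq : q ∈ Q')
  obtain ⟨m, rfl⟩ : ∃ j, m = j + 1 := ⟨m - 1, by omega⟩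
  have : (⟨q, hq⟩ : Q) = h ((h ^ m) s) := by
    rw [← Module.End.mul_apply, ← pow_succ']
    exact Subtype.ext hr.symm
  rw [this]
  exact (l _).2

universe u v

variable (A : Type u) (M : Type v) [Ring A] [IsArtinianRing A]
  [AddCommGroup M] [Module A M] [Module.Finite A M]

/-- The module underlying a (chosen) projective cover of `M`. -/
def coverSubmodule : Submodule A (Fin (exists_projectiveCover A M).choose → A) :=
  (exists_projectiveCover A M).choose_spec.choose

/-- The projective cover `P(M)` of `M`. -/
def Cover : Type u := coverSubmodule A M

instance : AddCommGroup (Cover A M) := inferInstanceAs (AddCommGroup (coverSubmodule A M))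

instance : Module A (Cover A M) := inferInstanceAs (Module A (coverSubmodule A M))

instance : Module.Finite A (Cover A M) := inferInstanceAs (Module.Finite A (coverSubmodule A M))

/-- The projection `P(M) → M`. -/
def coverMap : Cover A M →ₗ[A] M :=
  (exists_projectiveCover A M).choose_spec.choose_spec.choose

theorem coverMap_isProjectiveCover : IsProjectiveCover (coverMap A M) :=
  (exists_projectiveCover A M).choose_spec.choose_spec.choose_spec

/-- Heller's syzygy `Ω M`: the kernel of the projective cover of `M`. -/
def Syzygy : Type u := LinearMap.ker (coverMap A M)

instance : AddCommGroup (Syzygy A M) := inferInstanceAs (AddCommGroup (LinearMap.ker (coverMap A M)))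

instance : Module A (Syzygy A M) := inferInstanceAs (Module A (LinearMap.ker (coverMap A M)))

instance : Module.Finite A (Syzygy A M) :=
  inferInstanceAs (Module.Finite A (LinearMap.ker (coverMap A M)))

/-- The inclusion `Ω M → P(M)`. -/
def syzygyInclusion : Syzygy A M →ₗ[A] Cover A M := (LinearMap.ker (coverMap A M)).subtype

/-- The map `P(Ω M) → P(M)`, with cokernel `M`: the minimal projective presentation of `M`. -/
def presentationMap : Cover A (Syzygy A M) →ₗ[A] Cover A M :=
  syzygyInclusion A M ∘ₗ coverMap A (Syzygy A M)

/-- The transpose `Tr M`, a right `A`-module: the cokernel of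
`Hom_A(P(M), A) → Hom_A(P(Ω M), A)`. Right `A`-modules are `Aᵐᵒᵖ`-modules. -/
def Transpose : Type u :=
  (Cover A (Syzygy A M) →ₗ[A] A) ⧸
    LinearMap.range (LinearMap.lcomp Aᵐᵒᵖ A (presentationMap A M))

section TransposeInstances

instance : AddCommGroup (Transpose A M) :=
  inferInstanceAs (AddCommGroup ((Cover A (Syzygy A M) →ₗ[A] A) ⧸
    LinearMap.range (LinearMap.lcomp Aᵐᵒᵖ A (presentationMap A M))))

instance : Module Aᵐᵒᵖ (Transpose A M) :=
  inferInstanceAs (Module Aᵐᵒᵖ ((Cover A (Syzygy A M) →ₗ[A] A) ⧸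
    LinearMap.range (LinearMap.lcomp Aᵐᵒᵖ A (presentationMap A M))))

variable (k : Type*) [Field k] [Algebra k A]

instance : Module k (Transpose A M) :=
  inferInstanceAs (Module k ((Cover A (Syzygy A M) →ₗ[A] A) ⧸
    LinearMap.range (LinearMap.lcomp Aᵐᵒᵖ A (presentationMap A M))))

instance : IsScalarTower k Aᵐᵒᵖ (Transpose A M) :=
  inferInstanceAs (IsScalarTower k Aᵐᵒᵖ ((Cover A (Syzygy A M) →ₗ[A] A) ⧸
    LinearMap.range (LinearMap.lcomp Aᵐᵒᵖ A (presentationMap A M))))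

end TransposeInstances

/-- The syzygy as an operation on finitely generated `A`-modules. -/
abbrev syzygy (N : FGModuleCat.{u} A) : FGModuleCat.{u} A :=
  FGModuleCat.of A (Syzygy A N)

/-- The iterated syzygy `Ω^n`. -/
def syzygyPow : ℕ → FGModuleCat.{u} A → FGModuleCat.{u} A
  | 0, N => N
  | n + 1, N => syzygy A (syzygyPow n N)

end Covers

/-! ### Duality over the ground field and the Auslander-Reiten translate -/

section Duality

variable (k : Type*) [Field k]

/-- The dual `D N = Hom_k(N, k)`; for a right `A`-module `N` it is a left `A`-module by
`(a • f) x = f (x a)`. -/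
def KDual (N : Type*) [AddCommGroup N] [Module k N] : Type _ := N →ₗ[k] k

variable {N : Type*} [AddCommGroup N] [Module k N]

instance : AddCommGroup (KDual k N) := inferInstanceAs (AddCommGroup (N →ₗ[k] k))

instance : Module k (KDual k N) := inferInstanceAs (Module k (N →ₗ[k] k))

instance : FunLike (KDual k N) N k := inferInstanceAs (FunLike (N →ₗ[k] k) N k)

instance : LinearMapClass (KDual k N) k N k :=
  inferInstanceAs (LinearMapClass (N →ₗ[k] k) k N k)

variable (A : Type*) [Ring A] [Algebra k A] [Module Aᵐᵒᵖ N] [IsScalarTower k Aᵐᵒᵖ N]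

instance : Module A (KDual k N) where
  smul a f := LinearMap.comp (M₂ := N) f (Algebra.lsmul k k N (op a))
  one_smul f := LinearMap.ext fun x => congrArg f (one_smul Aᵐᵒᵖ x)
  mul_smul a b f := LinearMap.ext fun x => congrArg f (mul_smul (op b) (op a) x)
  smul_zero _ := rfl
  smul_add _ _ _ := rfl
  add_smul a b f := LinearMap.ext fun x =>
    (congrArg f (add_smul (op a) (op b) x)).trans (map_add f _ _)
  zero_smul f := LinearMap.ext fun x => (congrArg f (zero_smul Aᵐᵒᵖ x)).trans (map_zero f)

theorem KDual.smul_apply (a : A) (f : KDual k N) (x : N) : (a • f) x = f (op a • x) := rfl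

instance : IsScalarTower k A (KDual k N) where
  smul_assoc c a f := LinearMap.ext fun x =>
    (congrArg f (smul_assoc c (op a) x)).trans (map_smul f c (op a • x))

/-- The map `D N' → D N` induced by a map `N → N'` of right `A`-modules. -/
def KDual.map {N' : Type*} [AddCommGroup N'] [Module k N'] [Module Aᵐᵒᵖ N']
    [IsScalarTower k Aᵐᵒᵖ N'] (f : N →ₗ[Aᵐᵒᵖ] N') : KDual k N' →ₗ[A] KDual k N where
  toFun g := LinearMap.comp (M₂ := N') g (f.restrictScalars k)
  map_add' _ _ := rfl
  map_smul' a g := LinearMap.ext fun x => congrArg g (map_smul f (op a) x).symm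

section Tau

variable {k} {A : Type*} [Ring A] [Algebra k A] [IsArtinianRing A]

/-- The Auslander-Reiten translate `τ M = D Tr M`. -/
abbrev Tau (k : Type*) [Field k] (A : Type*) [Ring A] [Algebra k A] [IsArtinianRing A]
    (M : Type*) [AddCommGroup M] [Module A M] [Module.Finite A M] : Type _ :=
  KDual k (Transpose A M)

/-- The higher Auslander-Reiten translate `τ_n M = τ (Ω^{n-1} M)`. -/
def TauN (k : Type*) [Field k] {A : Type*} [Ring A] [Algebra k A] [IsArtinianRing A]
    (n : ℕ) (M : FGModuleCat A) : Type _ :=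
  Tau k A (syzygyPow A (n - 1) M)

variable (n : ℕ) (M : FGModuleCat A)

instance : AddCommGroup (TauN k n M) :=
  inferInstanceAs (AddCommGroup (Tau k A (syzygyPow A (n - 1) M)))

instance : Module k (TauN k n M) :=
  inferInstanceAs (Module k (Tau k A (syzygyPow A (n - 1) M)))

instance : Module A (TauN k n M) :=
  inferInstanceAs (Module A (Tau k A (syzygyPow A (n - 1) M)))

instance : IsScalarTower k A (TauN k n M) :=
  inferInstanceAs (IsScalarTower k A (Tau k A (syzygyPow A (n - 1) M)))

end Tau

end Duality

/-! ### Tensor product of a right and a left module over a noncommutative algebra -/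

section Balanced

variable (k A : Type*) [Field k] [Ring A] [Algebra k A]

/-- The subspace of `N ⊗ P` spanned by the elements `na ⊗ p - n ⊗ ap`. -/
def balancedRel (N P : Type*) [AddCommGroup N] [Module k N] [Module Aᵐᵒᵖ N]
    [AddCommGroup P] [Module k P] [Module A P] : Submodule k (N ⊗[k] P) :=
  Submodule.span k {z | ∃ (a : A) (n : N) (p : P), z = (op a • n) ⊗ₜ[k] p - n ⊗ₜ[k] (a • p)}

/-- The tensor product `N ⊗_A P` of a right `A`-module `N` and a left `A`-module `P`. -/
abbrev BalancedTensor (N P : Type*) [AddCommGroup N] [Module k N] [Module Aᵐᵒᵖ N]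
    [AddCommGroup P] [Module k P] [Module A P] : Type _ :=
  (N ⊗[k] P) ⧸ balancedRel k A N P

/-- The map `f ⊗ g : N ⊗_A P → N' ⊗_A P'`. -/
def BalancedTensor.map {N P N' P' : Type*}
    [AddCommGroup N] [Module k N] [Module Aᵐᵒᵖ N] [IsScalarTower k Aᵐᵒᵖ N]
    [AddCommGroup P] [Module k P] [Module A P] [IsScalarTower k A P]
    [AddCommGroup N'] [Module k N'] [Module Aᵐᵒᵖ N'] [IsScalarTower k Aᵐᵒᵖ N']
    [AddCommGroup P'] [Module k P'] [Module A P'] [IsScalarTower k A P']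
    (f : N →ₗ[Aᵐᵒᵖ] N') (g : P →ₗ[A] P') :
    BalancedTensor k A N P →ₗ[k] BalancedTensor k A N' P' :=
  Submodule.mapQ _ _ (TensorProduct.map (f.restrictScalars k) (g.restrictScalars k)) <| by
    refine Submodule.span_le.2 ?_
    rintro _ ⟨a, n, p, rfl⟩
    refine Submodule.subset_span ⟨a, f n, g p, ?_⟩
    simp

end Balanced

/-! ### Minimal projective resolutions -/

/-- `⋯ → P 1 → P 0 → M → 0`, with maps `d n : P (n+1) → P n` and `ε : P 0 → M`, is a minimal
projective resolution of `M` by finitely generated modules: it is exact, and each `P n` is a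
projective cover of the image of the map that leaves it. -/
structure IsMinimalProjectiveResolution {A M : Type*} [Ring A] [AddCommGroup M] [Module A M]
    {P : ℕ → Type*} [∀ n, AddCommGroup (P n)] [∀ n, Module A (P n)]
    (d : ∀ n, P (n + 1) →ₗ[A] P n) (ε : P 0 →ₗ[A] M) : Prop where
  finite : ∀ n, Module.Finite A (P n)
  exact_zero : Function.Exact (d 0) ε
  exact_succ : ∀ n, Function.Exact (d (n + 1)) (d n)
  cover_zero : IsProjectiveCover ε
  cover_succ : ∀ n, IsProjectiveCover (d n).rangeRestrict

/-! ### Bimodules -/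

section Bimodules

/-- The enveloping algebra `Λ ⊗ Λᵒᵖ`. A `Λ`-bimodule is a left module over it, by
`(a ⊗ b) • x = a x b`. -/
abbrev Env (k Λ : Type*) [Field k] [Ring Λ] [Algebra k Λ] : Type _ := Λ ⊗[k] Λᵐᵒᵖ

variable (k Λ : Type*) [Field k] [Ring Λ] [Algebra k Λ]

/-- The regular bimodule: `(a ⊗ b) • x = a x b`. -/
instance : Module (Env k Λ) Λ := TensorProduct.Algebra.module

theorem env_smul_def (a b x : Λ) : (a ⊗ₜ[k] op b : Env k Λ) • x = a * x * b := by
  rw [TensorProduct.Algebra.smul_def, op_smul_eq_mul, smul_eq_mul, mul_assoc]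

instance : IsScalarTower k (Env k Λ) Λ where
  smul_assoc c t x := by
    induction t using TensorProduct.induction_on with
    | zero =>
      have h : (0 : Env k Λ) • x = 0 := zero_smul (Env k Λ) x
      rw [smul_zero]
      exact h.trans ((congrArg (c • ·) h).trans (smul_zero c)).symm
    | add s t hs ht => simp only [smul_add, add_smul, hs, ht]
    | tmul a b =>
      rw [TensorProduct.smul_tmul', TensorProduct.Algebra.smul_def,
        TensorProduct.Algebra.smul_def, smul_assoc]

instance [Module.Finite k Λ] : Module.Finite k Λᵐᵒᵖ :=
  Module.Finite.equiv (opLinearEquiv k (M := Λ))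

instance [Module.Finite k Λ] : IsArtinianRing (Env k Λ) := IsArtinianRing.of_finite k _

instance [Module.Finite k Λ] : Module.Finite (Env k Λ) Λ :=
  Module.Finite.of_restrictScalars_finite k _ _

/-- The anti-automorphism `a ⊗ b ↦ b ⊗ a` of the enveloping algebra. -/
def swap : (Env k Λ)ᵐᵒᵖ ≃ₐ[k] Env k Λ :=
  (Algebra.TensorProduct.opAlgEquiv k k Λ Λᵐᵒᵖ).symm.trans <|
    (Algebra.TensorProduct.congr AlgEquiv.refl (AlgEquiv.opOp k Λ).symm).trans <|
      Algebra.TensorProduct.comm k Λᵐᵒᵖ Λ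

theorem swap_op_tmul (a b : Λ) : swap k Λ (op (a ⊗ₜ op b)) = b ⊗ₜ op a := rfl

/-- A `Λ`-bimodule `X`, regarded as a right module over the enveloping algebra:
`x • (a ⊗ b) = b x a`. -/
def AsRight (X : Type*) : Type _ := X

variable {X : Type*} [AddCommGroup X] [Module k X] [Module (Env k Λ) X]

instance : AddCommGroup (AsRight X) := inferInstanceAs (AddCommGroup X)

instance : Module k (AsRight X) := inferInstanceAs (Module k X)

instance : Module (Env k Λ)ᵐᵒᵖ (AsRight X) :=
  Module.compHom X ((swap k Λ : (Env k Λ)ᵐᵒᵖ →ₐ[k] Env k Λ) : (Env k Λ)ᵐᵒᵖ →+* Env k Λ)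

/-- The identity map from `X` to `X` as a right module. -/
def AsRight.of : X ≃ₗ[k] AsRight X := LinearEquiv.refl k X

theorem AsRight.smul_of (t : (Env k Λ)ᵐᵒᵖ) (x : X) :
    t • AsRight.of k x = AsRight.of k (swap k Λ t • x) := rfl

instance [IsScalarTower k (Env k Λ) X] : IsScalarTower k (Env k Λ)ᵐᵒᵖ (AsRight X) where
  smul_assoc c t x :=
    (congrArg (fun s : Env k Λ => s • (AsRight.of k).symm x) (map_smul (swap k Λ) c t)).trans
      (smul_assoc c (swap k Λ t) ((AsRight.of k).symm x))

/-- A map of bimodules, regarded as a map of right modules. -/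
def AsRight.map {k Λ} [Field k] [Ring Λ] [Algebra k Λ] {X Y : Type*}
    [AddCommGroup X] [Module (Env k Λ) X] [AddCommGroup Y] [Module (Env k Λ) Y]
    (f : X →ₗ[Env k Λ] Y) : AsRight X →ₗ[(Env k Λ)ᵐᵒᵖ] AsRight Y where
  toFun := f
  map_add' := map_add f
  map_smul' t x := map_smul f (swap k Λ t) (show X from x)

/-- The dual bimodule `D X`: `(a f b) x = f (b x a)`. -/
abbrev DualBimodule (X : Type*) [AddCommGroup X] [Module k X] : Type _ := KDual k (AsRight X)

end Bimodules

/-! ### `τ`-Hochschild cohomology and homology -/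

section TauHH

variable (k Λ : Type*) [Field k] [Ring Λ] [Algebra k Λ] [Module.Finite k Λ]

/-- The regular bimodule as an object of the category of finitely generated bimodules. -/
abbrev regular : FGModuleCat (Env k Λ) := FGModuleCat.of (Env k Λ) Λ

/-- `HH^n_τ(Λ, X) = D Hom_{Λ-Λ}(X, τ_n Λ)`. -/
abbrev TauCohomology (n : ℕ) (X : Type*) [AddCommGroup X] [Module (Env k Λ) X] : Type _ :=
  Module.Dual k (X →ₗ[Env k Λ] TauN k n (regular k Λ))

/-- `HH_n^τ(Λ, X) = Hom_{Λ-Λ}(D X, τ_n Λ)`. -/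
abbrev TauHomology (n : ℕ) (X : Type*) [AddCommGroup X] [Module k X] [Module (Env k Λ) X]
    [IsScalarTower k (Env k Λ) X] : Type _ :=
  DualBimodule k X →ₗ[Env k Λ] TauN k n (regular k Λ)

variable {X Y : Type*} [AddCommGroup X] [Module k X] [Module (Env k Λ) X]
  [IsScalarTower k (Env k Λ) X]
  [AddCommGroup Y] [Module k Y] [Module (Env k Λ) Y] [IsScalarTower k (Env k Λ) Y]

/-- The map `HH^n_τ(Λ, X) → HH^n_τ(Λ, Y)` induced by a map of bimodules `X → Y`. -/
def TauCohomology.map (n : ℕ) (f : X →ₗ[Env k Λ] Y) :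
    TauCohomology k Λ n X →ₗ[k] TauCohomology k Λ n Y :=
  (LinearMap.lcomp k (TauN k n (regular k Λ)) f).dualMap

/-- The map `HH_n^τ(Λ, X) → HH_n^τ(Λ, Y)` induced by a map of bimodules `X → Y`. -/
def TauHomology.map (n : ℕ) (f : X →ₗ[Env k Λ] Y) :
    TauHomology k Λ n X →ₗ[k] TauHomology k Λ n Y :=
  LinearMap.lcomp k (TauN k n (regular k Λ)) (KDual.map k (Env k Λ) (AsRight.map f))

end TauHH

/-! ### The Hom complex and the tensor complex -/

section Complexes

variable {k Λ : Type*} [Field k] [Ring Λ] [Algebra k Λ]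
  {P Q : Type*} [AddCommGroup P] [Module k P] [Module (Env k Λ) P] [IsScalarTower k (Env k Λ) P]
  [AddCommGroup Q] [Module k Q] [Module (Env k Λ) Q] [IsScalarTower k (Env k Λ) Q]

/-- `δ = Hom_{Λ-Λ}(d, X) : Hom_{Λ-Λ}(Q, X) → Hom_{Λ-Λ}(P, X)` for `d : P → Q`. -/
def homDifferential (d : P →ₗ[Env k Λ] Q) (X : Type*) [AddCommGroup X] [Module k X]
    [Module (Env k Λ) X] [IsScalarTower k (Env k Λ) X] :
    (Q →ₗ[Env k Λ] X) →ₗ[k] (P →ₗ[Env k Λ] X) :=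
  LinearMap.lcomp k X d

/-- `δ' = X ⊗_{Λ-Λ} d : X ⊗_{Λ-Λ} P → X ⊗_{Λ-Λ} Q` for `d : P → Q`. -/
def tensorDifferential (d : P →ₗ[Env k Λ] Q) (X : Type*) [AddCommGroup X] [Module k X]
    [Module (Env k Λ) X] [IsScalarTower k (Env k Λ) X] :
    BalancedTensor k (Env k Λ) (AsRight X) P →ₗ[k] BalancedTensor k (Env k Λ) (AsRight X) Q :=
  BalancedTensor.map k (Env k Λ) LinearMap.id d

end Complexes

end TauHochschild

end

open TauHochschild

universe w

noncomputable section

namespace TauHochschild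

/-! ### Uniqueness of projective covers -/

section CoverUniqueness

variable {A P Q M N : Type*} [Ring A] [AddCommGroup P] [Module A P] [AddCommGroup Q] [Module A Q]
  [AddCommGroup M] [Module A M] [AddCommGroup N] [Module A N]

/-- Two projective covers of the same module are isomorphic over it. -/
theorem IsProjectiveCover.exists_equiv {f : P →ₗ[A] M} {g : Q →ₗ[A] M}
    (hf : IsProjectiveCover f) (hg : IsProjectiveCover g) :
    ∃ e : P ≃ₗ[A] Q, g ∘ₗ (e : P →ₗ[A] Q) = f := by
  have := hf.projective
  have := hg.projective
  obtain ⟨h, hh⟩ := Module.projective_lifting_property g f hg.surjective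
  have hgh : ∀ p, g (h p) = f p := LinearMap.congr_fun hh
  have hs : Function.Surjective h := by
    refine LinearMap.range_eq_top.1 (hg.superfluous _ (eq_top_iff.2 fun q _ => ?_))
    obtain ⟨p, hp⟩ := hf.surjective (g q)
    refine Submodule.mem_sup.2 ⟨h p, ⟨p, rfl⟩, q - h p, ?_, add_sub_cancel _ _⟩
    rw [LinearMap.mem_ker, map_sub, hgh, hp, sub_self]
  obtain ⟨s, hs'⟩ := Module.projective_lifting_property h LinearMap.id hs
  have hsr : ∀ q, h (s q) = q := LinearMap.congr_fun hs'
  have hss : Function.Surjective s := by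
    refine LinearMap.range_eq_top.1 (hf.superfluous _ (eq_top_iff.2 fun p _ => ?_))
    refine Submodule.mem_sup.2 ⟨s (h p), ⟨h p, rfl⟩, p - s (h p), ?_, add_sub_cancel _ _⟩
    rw [LinearMap.mem_ker, map_sub, ← hgh, ← hgh, hsr, sub_self]
  have hi : Function.Injective h := by
    intro p p' hpp
    obtain ⟨q, rfl⟩ := hss p
    obtain ⟨q', rfl⟩ := hss p'
    rw [hsr, hsr] at hpp
    rw [hpp]
  exact ⟨LinearEquiv.ofBijective h ⟨hi, hs⟩, hh⟩

theorem IsProjectiveCover.equiv_comp {f : P →ₗ[A] M} (hf : IsProjectiveCover f) (e : M ≃ₗ[A] N) :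
    IsProjectiveCover ((e : M →ₗ[A] N) ∘ₗ f) where
  projective := hf.projective
  surjective := e.surjective.comp hf.surjective
  superfluous := by
    rw [LinearEquiv.ker_comp]
    exact hf.superfluous

end CoverUniqueness

section Resolution

universe u v

variable {A : Type u} [Ring A] [IsArtinianRing A]

/-- If `f : P → M` is a projective cover with kernel the image of `d : P' → P`, and `P'` is a
projective cover of that image, then `P'` is a projective cover of `Ω M`, compatibly with an
isomorphism `P ≃ P(M)`. -/
theorem exists_cover_syzygy {P P' : Type*} {M : Type v} [AddCommGroup M] [Module A M]
    [Module.Finite A M] [AddCommGroup P] [Module A P] [AddCommGroup P'] [Module A P']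
    {f : P →ₗ[A] M} {d : P' →ₗ[A] P} (hf : IsProjectiveCover f) (hdf : Function.Exact d f)
    (hd : IsProjectiveCover d.rangeRestrict) :
    ∃ (a : P ≃ₗ[A] Cover A M) (g : P' →ₗ[A] Syzygy A M), IsProjectiveCover g ∧
      (∀ x, a (d x) = syzygyInclusion A M (g x)) := by
  obtain ⟨a, ha⟩ := hf.exists_equiv (coverMap_isProjectiveCover A M)
  have hmap : (LinearMap.range d).map (a : P →ₗ[A] Cover A M) = LinearMap.ker (coverMap A M) := by
    rw [← LinearMap.exact_iff.1 hdf, ← ha, LinearMap.ker_comp,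
      Submodule.map_comap_eq_of_surjective a.surjective]
  let e : LinearMap.range d ≃ₗ[A] LinearMap.ker (coverMap A M) :=
    (a.submoduleMap (LinearMap.range d)).trans (LinearEquiv.ofEq _ _ hmap)
  exact ⟨a, _, hd.equiv_comp e, fun _ => rfl⟩

variable {M : FGModuleCat.{u} A} {P : ℕ → Type*} [∀ n, AddCommGroup (P n)] [∀ n, Module A (P n)]
  {d : ∀ n, P (n + 1) →ₗ[A] P n} {ε : P 0 →ₗ[A] M}

/-- The `n`-th term of a minimal projective resolution is a projective cover of `Ω^n M`. -/
theorem IsMinimalProjectiveResolution.exists_cover_syzygyPow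
    (hP : IsMinimalProjectiveResolution d ε) (n : ℕ) :
    ∃ f : P n →ₗ[A] syzygyPow A n M, IsProjectiveCover f ∧ Function.Exact (d n) f := by
  induction n with
  | zero => exact ⟨ε, hP.cover_zero, hP.exact_zero⟩
  | succ n ih =>
    obtain ⟨f, hf, hdf⟩ := ih
    obtain ⟨a, g, hg, hag⟩ := exists_cover_syzygy hf hdf (hP.cover_succ n)
    refine ⟨g, hg, fun x => ?_⟩
    have hz : g x = 0 ↔ d n x = 0 := by
      rw [← map_eq_zero_iff a a.injective, hag]
      exact (map_eq_zero_iff (syzygyInclusion A (syzygyPow A n M))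
        (Submodule.injective_subtype _)).symm
    exact hz.trans (hP.exact_succ n x)

/-- The transpose of `Ω^n M` is the cokernel of `Hom(P n, A) → Hom(P (n+1), A)`. -/
theorem IsMinimalProjectiveResolution.exists_transpose
    (hP : IsMinimalProjectiveResolution d ε) (n : ℕ) :
    ∃ π : (P (n + 1) →ₗ[A] A) →ₗ[Aᵐᵒᵖ] Transpose A (syzygyPow A n M),
      Function.Surjective π ∧
        ∀ f, π f = 0 ↔ ∃ g : P n →ₗ[A] A, g ∘ₗ d n = f := by
  obtain ⟨f, hf, hdf⟩ := hP.exists_cover_syzygyPow n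
  obtain ⟨a, g, hg, hag⟩ := exists_cover_syzygy hf hdf (hP.cover_succ n)
  obtain ⟨b, hb⟩ := hg.exists_equiv (coverMap_isProjectiveCover A _)
  have hsq : ∀ x, a (d n x) = presentationMap A (syzygyPow A n M) (b x) := fun x => by
    rw [hag, ← hb]; rfl
  let R := LinearMap.range (LinearMap.lcomp Aᵐᵒᵖ A (presentationMap A (syzygyPow A n M)))
  let π : (P (n + 1) →ₗ[A] A) →ₗ[Aᵐᵒᵖ] _ ⧸ R :=
    R.mkQ ∘ₗ LinearMap.lcomp Aᵐᵒᵖ A (b.symm : _ →ₗ[A] P (n + 1))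
  refine ⟨π, ?_, fun φ => ?_⟩
  · refine R.mkQ_surjective.comp fun φ => ⟨φ ∘ₗ (b : P (n + 1) →ₗ[A] _), ?_⟩
    exact LinearMap.ext fun x => congrArg φ (b.apply_symm_apply x)
  · refine (Submodule.Quotient.mk_eq_zero R).trans ⟨?_, ?_⟩
    · rintro ⟨ψ, hψ⟩
      refine ⟨ψ ∘ₗ (a : P n →ₗ[A] _), LinearMap.ext fun x => ?_⟩
      have := LinearMap.congr_fun hψ (b x)
      refine (congrArg ψ (hsq x)).trans (this.trans ?_)
      exact congrArg φ (b.symm_apply_apply x)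
    · rintro ⟨ψ, rfl⟩
      refine ⟨ψ ∘ₗ (a.symm : _ →ₗ[A] P n), LinearMap.ext fun x => ?_⟩
      refine congrArg ψ (a.symm_apply_eq.2 ?_)
      refine (congrArg _ (b.apply_symm_apply x).symm).trans (hsq _).symm

end Resolution


/-! ### Maps into the dual of a transpose -/

section HomKDual

/-- A finitely generated projective module has a finite dual basis. -/
theorem exists_dualBasis (A P : Type*) [Ring A] [AddCommGroup P] [Module A P]
    [Module.Finite A P] [Module.Projective A P] :
    ∃ (m : ℕ) (b : Fin m → P) (c : Fin m → P →ₗ[A] A), ∀ p, ∑ i, c i p • b i = p := by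
  obtain ⟨m, g, s, -, -, hgs⟩ := Module.Finite.exists_comp_eq_id_of_projective A P
  refine ⟨m, fun i => g (Pi.single i 1), fun i => LinearMap.proj i ∘ₗ s, fun p => ?_⟩
  calc _ = g (∑ i, s p i • Pi.single i 1) := by simp
    _ = g (s p) := by
      congr 1
      ext j
      simp [Finset.sum_apply, Pi.single_apply]
    _ = p := LinearMap.congr_fun hgs p

variable {k A : Type*} [Field k] [Ring A] [Algebra k A]
  {P Q N : Type*} [AddCommGroup P] [Module A P] [AddCommGroup Q] [Module A Q]
  [AddCommGroup N] [Module k N] [Module Aᵐᵒᵖ N] [IsScalarTower k Aᵐᵒᵖ N]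

/-- The cokernel of `Hom_A(Q, X) → Hom_A(P, X)`. -/
abbrev HomCoker (k : Type*) [Field k] [Algebra k A] (d : P →ₗ[A] Q) (X : Type*) [AddCommGroup X]
    [Module k X] [Module A X] [IsScalarTower k A X] : Type _ :=
  (P →ₗ[A] X) ⧸ LinearMap.range (LinearMap.lcomp k X d)

variable {d : P →ₗ[A] Q} {π : (P →ₗ[A] A) →ₗ[Aᵐᵒᵖ] N} {ι : Type*} [Fintype ι]
  (b : ι → P) (c : ι → P →ₗ[A] A)

theorem apply_eq_sum_dualBasis {b : ι → P} {c : ι → P →ₗ[A] A}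
    (hbc : ∀ p, ∑ i, c i p • b i = p) {X : Type*} [AddCommGroup X] [Module A X]
    (φ : P →ₗ[A] X) : φ = ∑ i, (c i).smulRight (φ (b i)) := by
  ext p
  conv_lhs => rw [← hbc p]
  simp [LinearMap.sum_apply]

variable (X : Type*) [AddCommGroup X] [Module k X] [Module A X] [IsScalarTower k A X]

variable (π) in
/-- The map `Hom_A(X, D N) → D Hom_A(P, X)` given by `h ↦ (φ ↦ ∑ h (φ (b i)) (π (c i)))`. -/
def homKDualPairing : (X →ₗ[A] KDual k N) →ₗ[k] Module.Dual k (P →ₗ[A] X) :=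
  LinearMap.mk₂ k (fun h φ => ∑ i, h (φ (b i)) (π (c i)))
    (fun h h' φ => by
      rw [← Finset.sum_add_distrib]; rfl)
    (fun r h φ => by
      rw [Finset.smul_sum]; rfl)
    (fun h φ φ' => by
      rw [← Finset.sum_add_distrib]
      exact Finset.sum_congr rfl fun i _ => congrArg (· (π (c i))) (map_add h (φ (b i)) (φ' (b i))))
    (fun r h φ => by
      rw [Finset.smul_sum]
      exact Finset.sum_congr rfl fun i _ =>
        congrArg (· (π (c i))) ((h.restrictScalars k).map_smul r (φ (b i))))

variable {X}

theorem homKDualPairing_smulRight {b : ι → P} {c : ι → P →ₗ[A] A}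
    (hbc : ∀ p, ∑ i, c i p • b i = p) (h : X →ₗ[A] KDual k N) (x : X) (f : P →ₗ[A] A) :
    homKDualPairing π b c X h (f.smulRight x) = h x (π f) := by
  have hf : f = ∑ i, op (f (b i)) • c i := by
    conv_lhs => rw [apply_eq_sum_dualBasis hbc f]
    rfl
  conv_rhs => rw [hf, map_sum, map_sum]
  refine Finset.sum_congr rfl fun i _ => ?_
  rw [LinearMap.smulRight_apply, map_smul, KDual.smul_apply]
  exact congrArg (h x) (map_smul π (op (f (b i))) (c i)).symm

theorem homKDualPairing_range [Module.Finite A Q] [Module.Projective A Q]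
    {b : ι → P} {c : ι → P →ₗ[A] A} (hbc : ∀ p, ∑ i, c i p • b i = p)
    (hπ : ∀ f, π f = 0 ↔ ∃ g : Q →ₗ[A] A, g ∘ₗ d = f)
    (h : X →ₗ[A] KDual k N) :
    LinearMap.range (LinearMap.lcomp k X d) ≤ LinearMap.ker (homKDualPairing π b c X h) := by
  rintro _ ⟨ψ, rfl⟩
  obtain ⟨m, b', c', hbc'⟩ := exists_dualBasis A Q
  have hψ : LinearMap.lcomp k X d ψ = ∑ j, (c' j ∘ₗ d).smulRight (ψ (b' j)) := by
    conv_lhs => rw [apply_eq_sum_dualBasis hbc' ψ]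
    rw [map_sum]
    rfl
  rw [LinearMap.mem_ker, hψ, map_sum]
  refine Finset.sum_eq_zero fun j _ => ?_
  rw [homKDualPairing_smulRight hbc, (hπ _).2 ⟨_, rfl⟩, map_zero]

theorem homKDualPairing_injective {b : ι → P} {c : ι → P →ₗ[A] A}
    (hbc : ∀ p, ∑ i, c i p • b i = p) (hs : Function.Surjective π) :
    Function.Injective (homKDualPairing (k := k) π b c X) := by
  rw [injective_iff_map_eq_zero]
  intro h hh
  refine LinearMap.ext fun x => LinearMap.ext fun n => ?_
  obtain ⟨f, rfl⟩ := hs n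
  exact (homKDualPairing_smulRight hbc h x f).symm.trans (LinearMap.congr_fun hh _)

theorem exists_homKDualPairing_eq {b : ι → P} {c : ι → P →ₗ[A] A}
    (hbc : ∀ p, ∑ i, c i p • b i = p) (hs : Function.Surjective π)
    (hπ : ∀ f, π f = 0 ↔ ∃ g : Q →ₗ[A] A, g ∘ₗ d = f)
    (α : Module.Dual k (P →ₗ[A] X)) (hα : ∀ ψ : Q →ₗ[A] X, α (ψ ∘ₗ d) = 0) :
    ∃ h, homKDualPairing π b c X h = α := by
  obtain ⟨σ, hσ⟩ := (π.restrictScalars k).exists_rightInverse_of_surjective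
    (LinearMap.range_eq_top.2 hs)
  have key : ∀ (f : P →ₗ[A] A) (x : X), α ((σ (π f)).smulRight x) = α (f.smulRight x) := by
    intro f x
    have hz : π (σ (π f) - f) = 0 := by
      rw [map_sub, sub_eq_zero]
      exact LinearMap.congr_fun hσ (π f)
    obtain ⟨g, hg⟩ := (hπ _).1 hz
    rw [← sub_eq_zero, ← map_sub]
    refine (congrArg α ?_).trans (hα (g.smulRight x))
    ext p
    have := LinearMap.congr_fun hg p
    simp only [LinearMap.sub_apply, LinearMap.smulRight_apply, LinearMap.comp_apply] at this ⊢
    rw [this, sub_smul]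
  let B : X →ₗ[k] N →ₗ[k] k := LinearMap.mk₂ k (fun x n => α ((σ n).smulRight x))
    (fun x x' n => by
      rw [← map_add]; congr 1; ext p; simp)
    (fun r x n => by
      rw [← map_smul]; congr 1; ext p; exact smul_comm (σ n p) r x)
    (fun x n n' => by
      rw [← map_add]; congr 1; ext p; simp [add_smul])
    (fun r x n => by
      rw [← map_smul]; congr 1; ext p; simp)
  let h : X →ₗ[A] KDual k N :=
    { toFun := B
      map_add' := map_add B
      map_smul' := fun a x => LinearMap.ext fun n => by
        obtain ⟨f, rfl⟩ := hs n
        refine (key f (a • x)).trans ?_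
        refine Eq.trans (congrArg α ?_) ((key (op a • f) x).symm.trans ?_)
        · ext p
          simp [mul_smul]
        · rw [map_smul]; rfl }
  refine ⟨h, LinearMap.ext fun φ => ?_⟩
  conv_lhs => rw [apply_eq_sum_dualBasis hbc φ]
  conv_rhs => rw [apply_eq_sum_dualBasis hbc φ]
  rw [map_sum, map_sum]
  refine Finset.sum_congr rfl fun i _ => ?_
  rw [homKDualPairing_smulRight hbc]
  exact key _ _

variable (X) in
/-- The map `Hom_A(X, D N) → D Coker(Hom_A(Q, X) → Hom_A(P, X))`. -/
def homKDualToDual [Module.Finite A Q] [Module.Projective A Q]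
    {b : ι → P} {c : ι → P →ₗ[A] A} (hbc : ∀ p, ∑ i, c i p • b i = p)
    (hπ : ∀ f, π f = 0 ↔ ∃ g : Q →ₗ[A] A, g ∘ₗ d = f) :
    (X →ₗ[A] KDual k N) →ₗ[k] Module.Dual k (HomCoker k d X) where
  toFun h := Submodule.liftQ _ (homKDualPairing π b c X h) (homKDualPairing_range hbc hπ h)
  map_add' h h' := Submodule.linearMap_qext _ (map_add (homKDualPairing π b c X) h h')
  map_smul' r h := Submodule.linearMap_qext _ (map_smul (homKDualPairing π b c X) r h)

theorem homKDualToDual_surjective [Module.Finite A Q] [Module.Projective A Q]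
    {b : ι → P} {c : ι → P →ₗ[A] A} (hbc : ∀ p, ∑ i, c i p • b i = p)
    (hs : Function.Surjective π) (hπ : ∀ f, π f = 0 ↔ ∃ g : Q →ₗ[A] A, g ∘ₗ d = f) :
    Function.Surjective (homKDualToDual (k := k) X hbc hπ) := by
  intro α
  let R := LinearMap.range (LinearMap.lcomp k X d)
  have hR : ∀ ψ : Q →ₗ[A] X, R.mkQ (ψ ∘ₗ d) = 0 := fun ψ =>
    (Submodule.Quotient.mk_eq_zero R).2 ⟨ψ, rfl⟩
  obtain ⟨h, hh⟩ := exists_homKDualPairing_eq hbc hs hπ (α ∘ₗ R.mkQ) fun ψ => by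
    rw [LinearMap.comp_apply, hR, map_zero]
  exact ⟨h, Submodule.linearMap_qext _ hh⟩

variable (X) in
/-- If `N` is the cokernel of `Hom_A(Q, A) → Hom_A(P, A)`, then `Hom_A(X, D N)` is the dual of
the cokernel of `Hom_A(Q, X) → Hom_A(P, X)`. -/
def homKDualEquiv [Module.Finite A Q] [Module.Projective A Q]
    {b : ι → P} {c : ι → P →ₗ[A] A} (hbc : ∀ p, ∑ i, c i p • b i = p)
    (hs : Function.Surjective π)
    (hπ : ∀ f, π f = 0 ↔ ∃ g : Q →ₗ[A] A, g ∘ₗ d = f) :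
    (X →ₗ[A] KDual k N) ≃ₗ[k] Module.Dual k (HomCoker k d X) :=
  LinearEquiv.ofBijective (homKDualToDual X hbc hπ)
    ⟨fun _ _ hh => homKDualPairing_injective hbc hs <| LinearMap.ext fun φ =>
      LinearMap.congr_fun hh (Submodule.Quotient.mk φ), homKDualToDual_surjective hbc hs hπ⟩

theorem homKDualEquiv_comp [Module.Finite A Q] [Module.Projective A Q]
    {b : ι → P} {c : ι → P →ₗ[A] A} (hbc : ∀ p, ∑ i, c i p • b i = p)
    (hs : Function.Surjective π)
    (hπ : ∀ f, π f = 0 ↔ ∃ g : Q →ₗ[A] A, g ∘ₗ d = f)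
    {Y : Type*} [AddCommGroup Y] [Module k Y] [Module A Y] [IsScalarTower k A Y]
    (f : X →ₗ[A] Y) (h : Y →ₗ[A] KDual k N) (φ : P →ₗ[A] X) :
    homKDualEquiv X hbc hs hπ (h ∘ₗ f) (Submodule.Quotient.mk φ) =
      homKDualEquiv Y hbc hs hπ h (Submodule.Quotient.mk (f ∘ₗ φ)) := rfl

variable (k A P X) in
theorem finite_linearMap [Module.Finite A P] [Module.Finite k X] :
    Module.Finite k (P →ₗ[A] X) := by
  obtain ⟨m, g, hg⟩ := Module.Finite.exists_fin' A P
  let F : (P →ₗ[A] X) →ₗ[k] (Fin m → X) :=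
    { toFun := fun φ i => φ (g (Pi.single i 1))
      map_add' := fun _ _ => rfl
      map_smul' := fun _ _ => rfl }
  refine Module.Finite.of_injective F fun φ ψ h => ?_
  rw [← LinearMap.cancel_right hg]
  exact LinearMap.pi_ext' fun i => LinearMap.ext_ring (congrFun h i)

end HomKDual

/-! ### Maps into a dual and the tensor product -/

section Adjunction

variable {k A : Type*} [Field k] [Ring A] [Algebra k A]
  {P Q N N' : Type*} [AddCommGroup P] [Module k P] [Module A P] [IsScalarTower k A P]
  [AddCommGroup Q] [Module k Q] [Module A Q] [IsScalarTower k A Q]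
  [AddCommGroup N] [Module k N] [Module Aᵐᵒᵖ N] [IsScalarTower k Aᵐᵒᵖ N]
  [AddCommGroup N'] [Module k N'] [Module Aᵐᵒᵖ N'] [IsScalarTower k Aᵐᵒᵖ N']

variable (k A P N) in
/-- The adjunction isomorphism `Hom_A(P, D N) ≃ D (N ⊗_A P)`. -/
def tensorDualEquiv : (P →ₗ[A] KDual k N) ≃ₗ[k] Module.Dual k (BalancedTensor k A N P) where
  toFun φ := Submodule.liftQ _
    (TensorProduct.lift (LinearMap.mk₂ k (fun n p => φ p n)
      (fun n n' p => map_add (φ p) n n')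
      (fun r n p => map_smul (φ p) r n)
      (fun n p p' => congrArg (fun g : KDual k N => g n) (map_add φ p p'))
      (fun r n p => congrArg (fun g : KDual k N => g n) ((φ.restrictScalars k).map_smul r p)))) <| by
    refine Submodule.span_le.2 ?_
    rintro _ ⟨a, n, p, rfl⟩
    rw [SetLike.mem_coe, LinearMap.mem_ker, map_sub, sub_eq_zero]
    exact congrArg (fun g : KDual k N => g n) (map_smul φ a p).symm
  map_add' φ ψ := by
    refine Submodule.linearMap_qext _ (TensorProduct.ext' fun n p => rfl)
  map_smul' r φ := by
    refine Submodule.linearMap_qext _ (TensorProduct.ext' fun n p => rfl)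
  invFun w :=
    { toFun := fun p => LinearMap.comp w
        ((Submodule.mkQ (balancedRel k A N P)) ∘ₗ (TensorProduct.mk k N P).flip p)
      map_add' := fun p p' => LinearMap.ext fun n => by
        have : (balancedRel k A N P).mkQ (n ⊗ₜ[k] (p + p')) =
            (balancedRel k A N P).mkQ (n ⊗ₜ[k] p) + (balancedRel k A N P).mkQ (n ⊗ₜ[k] p') := by
          rw [TensorProduct.tmul_add, map_add]
        exact (congrArg w this).trans (map_add w _ _)
      map_smul' := fun a p => LinearMap.ext fun n => by
        refine congrArg w ((Submodule.Quotient.eq _).2 ?_)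
        rw [← Submodule.neg_mem_iff, neg_sub]
        exact Submodule.subset_span ⟨a, n, p, rfl⟩ }
  left_inv φ := LinearMap.ext fun p => LinearMap.ext fun n => rfl
  right_inv w := by
    refine Submodule.linearMap_qext _ (TensorProduct.ext' fun n p => rfl)

theorem tensorDualEquiv_map (f : N →ₗ[Aᵐᵒᵖ] N') (g : P →ₗ[A] Q) (φ : Q →ₗ[A] KDual k N')
    (z : BalancedTensor k A N P) :
    tensorDualEquiv k A Q N' φ (BalancedTensor.map k A f g z) =
      tensorDualEquiv k A P N (KDual.map k A f ∘ₗ φ ∘ₗ g) z := by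
  have : (tensorDualEquiv k A Q N' φ) ∘ₗ (BalancedTensor.map k A f g) =
      tensorDualEquiv k A P N (KDual.map k A f ∘ₗ φ ∘ₗ g) :=
    Submodule.linearMap_qext _ (TensorProduct.ext' fun n p => rfl)
  exact LinearMap.congr_fun this z

/-- Evaluation at a vector of `N ⊗_A P`, as a functional on `Hom_A(P, D N)`. -/
def tensorEval : BalancedTensor k A N P →ₗ[k] Module.Dual k (P →ₗ[A] KDual k N) :=
  (tensorDualEquiv k A P N).toLinearMap.flip

theorem tensorEval_injective :
    Function.Injective (tensorEval : BalancedTensor k A N P →ₗ[k] _) := by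
  rw [injective_iff_map_eq_zero]
  intro z hz
  refine (Module.forall_dual_apply_eq_zero_iff k z).1 fun w => ?_
  obtain ⟨φ, rfl⟩ := (tensorDualEquiv k A P N).surjective w
  exact LinearMap.congr_fun hz φ

theorem tensorEval_surjective [Module.Finite k (N ⊗[k] P)] :
    Function.Surjective (tensorEval : BalancedTensor k A N P →ₗ[k] _) := by
  intro β
  obtain ⟨z, hz⟩ := (Module.evalEquiv k (BalancedTensor k A N P)).surjective
    (β ∘ₗ (tensorDualEquiv k A P N).symm.toLinearMap)
  refine ⟨z, LinearMap.ext fun φ => ?_⟩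
  refine (LinearMap.congr_fun hz (tensorDualEquiv k A P N φ)).trans ?_
  exact congrArg β ((tensorDualEquiv k A P N).symm_apply_apply φ)

theorem tensorEval_map (d : P →ₗ[A] Q) (z : BalancedTensor k A N P) (ψ : Q →ₗ[A] KDual k N) :
    tensorEval (BalancedTensor.map k A LinearMap.id d z) ψ = tensorEval z (ψ ∘ₗ d) :=
  tensorDualEquiv_map LinearMap.id d ψ z

variable (N) in
/-- The map from the kernel of `N ⊗_A P → N ⊗_A Q` to the dual of the cokernel of
`Hom_A(Q, D N) → Hom_A(P, D N)`. -/
def kerTensorToDual (d : P →ₗ[A] Q) :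
    LinearMap.ker (BalancedTensor.map k A (LinearMap.id : N →ₗ[Aᵐᵒᵖ] N) d) →ₗ[k]
      Module.Dual k (HomCoker k d (KDual k N)) where
  toFun z := Submodule.liftQ _ (tensorEval z.1) <| by
    rintro _ ⟨ψ, rfl⟩
    have := tensorEval_map d z.1 ψ
    rw [LinearMap.mem_ker.1 z.2, map_zero] at this
    exact this.symm
  map_add' z z' := Submodule.linearMap_qext _ (map_add tensorEval z.1 z'.1)
  map_smul' r z := Submodule.linearMap_qext _ (map_smul tensorEval r z.1)

variable (N) in
/-- The kernel of `N ⊗_A P → N ⊗_A Q` is the dual of the cokernel of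
`Hom_A(Q, D N) → Hom_A(P, D N)`. -/
def kerTensorEquiv (d : P →ₗ[A] Q) [Module.Finite k (N ⊗[k] P)] :
    LinearMap.ker (BalancedTensor.map k A (LinearMap.id : N →ₗ[Aᵐᵒᵖ] N) d) ≃ₗ[k]
      Module.Dual k (HomCoker k d (KDual k N)) :=
  LinearEquiv.ofBijective (kerTensorToDual N d) <| by
    constructor
    · intro z z' hz
      refine Subtype.ext (tensorEval_injective (LinearMap.ext fun φ => ?_))
      exact LinearMap.congr_fun hz (Submodule.Quotient.mk φ)
    · intro β
      let R := LinearMap.range (LinearMap.lcomp k (KDual k N) d)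
      have hR : ∀ ψ : Q →ₗ[A] KDual k N, R.mkQ (ψ ∘ₗ d) = 0 := fun ψ =>
        (Submodule.Quotient.mk_eq_zero R).2 ⟨ψ, rfl⟩
      obtain ⟨z, hz⟩ := tensorEval_surjective (β ∘ₗ R.mkQ)
      refine ⟨⟨z, tensorEval_injective (LinearMap.ext fun ψ => ?_)⟩,
        Submodule.linearMap_qext _ hz⟩
      rw [tensorEval_map, hz, LinearMap.comp_apply, hR, map_zero, map_zero, LinearMap.zero_apply]

end Adjunction


section DualHom

variable {k A : Type*} [Field k] [Ring A] [Algebra k A]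
  {P Q N : Type*} [AddCommGroup P] [Module A P] [AddCommGroup Q] [Module A Q]
  [AddCommGroup N] [Module k N] [Module Aᵐᵒᵖ N] [IsScalarTower k Aᵐᵒᵖ N]
  [Module.Finite A P] [Module.Finite A Q] [Module.Projective A Q]
  {d : P →ₗ[A] Q} {π : (P →ₗ[A] A) →ₗ[Aᵐᵒᵖ] N} {ι : Type*} [Fintype ι]
  {b : ι → P} {c : ι → P →ₗ[A] A} (hbc : ∀ p, ∑ i, c i p • b i = p)
  (hs : Function.Surjective π)
  (hπ : ∀ f, π f = 0 ↔ ∃ g : Q →ₗ[A] A, g ∘ₗ d = f)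
  (X : Type*) [AddCommGroup X] [Module k X] [Module A X] [IsScalarTower k A X] [Module.Finite k X]

/-- If `N` is the cokernel of `Hom_A(Q, A) → Hom_A(P, A)`, then `D Hom_A(X, D N)` is the cokernel
of `Hom_A(Q, X) → Hom_A(P, X)` for finite dimensional `X`. -/
def dualHomKDualEquiv : Module.Dual k (X →ₗ[A] KDual k N) ≃ₗ[k] HomCoker k d X :=
  haveI := finite_linearMap k A P X
  (homKDualEquiv X hbc hs hπ).symm.dualMap.trans (Module.evalEquiv k (HomCoker k d X)).symm

theorem dualHomKDualEquiv_eq_iff (h : Module.Dual k (X →ₗ[A] KDual k N)) (z : HomCoker k d X) :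
    dualHomKDualEquiv hbc hs hπ X h = z ↔ ∀ g, h g = homKDualEquiv X hbc hs hπ g z := by
  have := finite_linearMap k A P X
  refine (LinearEquiv.symm_apply_eq _).trans ⟨fun hz g => ?_, fun hz => LinearMap.ext fun α => ?_⟩
  · refine Eq.trans ?_ (LinearMap.congr_fun hz (homKDualEquiv X hbc hs hπ g))
    exact congrArg h ((homKDualEquiv X hbc hs hπ).symm_apply_apply g).symm
  · refine (hz _).trans ?_
    exact congrArg (fun β => β z) ((homKDualEquiv X hbc hs hπ).apply_symm_apply α)

end DualHom

section HomDual

variable {k A : Type*} [Field k] [Ring A] [Algebra k A]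
  {P Q N T T' : Type*}
  [AddCommGroup P] [Module k P] [Module A P] [IsScalarTower k A P]
  [AddCommGroup Q] [Module k Q] [Module A Q] [IsScalarTower k A Q]
  [AddCommGroup N] [Module k N] [Module Aᵐᵒᵖ N] [IsScalarTower k Aᵐᵒᵖ N]
  [AddCommGroup T] [Module k T] [Module Aᵐᵒᵖ T] [IsScalarTower k Aᵐᵒᵖ T]
  [AddCommGroup T'] [Module k T'] [Module Aᵐᵒᵖ T'] [IsScalarTower k Aᵐᵒᵖ T']
  [Module.Finite A Q] [Module.Projective A Q] [Module.Finite k (T ⊗[k] P)]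
  [Module.Finite k (T' ⊗[k] P)]
  {d : P →ₗ[A] Q} {π : (P →ₗ[A] A) →ₗ[Aᵐᵒᵖ] N} {ι : Type*} [Fintype ι]
  {b : ι → P} {c : ι → P →ₗ[A] A} (hbc : ∀ p, ∑ i, c i p • b i = p)
  (hs : Function.Surjective π)
  (hπ : ∀ f, π f = 0 ↔ ∃ g : Q →ₗ[A] A, g ∘ₗ d = f)

variable (T) in
/-- If `N` is the cokernel of `Hom_A(Q, A) → Hom_A(P, A)`, then `Hom_A(D T, D N)` is the kernel
of `T ⊗_A P → T ⊗_A Q`. -/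
def homKDualKDualEquiv : (KDual k T →ₗ[A] KDual k N) ≃ₗ[k]
    LinearMap.ker (BalancedTensor.map k A (LinearMap.id : T →ₗ[Aᵐᵒᵖ] T) d) :=
  (homKDualEquiv (KDual k T) hbc hs hπ).trans (kerTensorEquiv T d).symm

theorem tensorEval_homKDualKDualEquiv (h : KDual k T →ₗ[A] KDual k N) (φ : P →ₗ[A] KDual k T) :
    tensorEval (homKDualKDualEquiv T hbc hs hπ h).1 φ =
      homKDualEquiv (KDual k T) hbc hs hπ h (Submodule.Quotient.mk φ) :=
  LinearMap.congr_fun ((kerTensorEquiv T d).apply_symm_apply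
    (homKDualEquiv (KDual k T) hbc hs hπ h)) (Submodule.Quotient.mk φ)

theorem homKDualKDualEquiv_comp (f : T →ₗ[Aᵐᵒᵖ] T') (h : KDual k T →ₗ[A] KDual k N) :
    (homKDualKDualEquiv T' hbc hs hπ (h ∘ₗ KDual.map k A f)).1 =
      BalancedTensor.map k A f LinearMap.id (homKDualKDualEquiv T hbc hs hπ h).1 := by
  refine tensorEval_injective (LinearMap.ext fun φ => ?_)
  rw [tensorEval_homKDualKDualEquiv, homKDualEquiv_comp, ← tensorEval_homKDualKDualEquiv]
  exact (tensorDualEquiv_map f LinearMap.id φ _).symm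

end HomDual

end TauHochschild
end

theorem mainTheorem2 {k Λ : Type*} [Field k] [Ring Λ] [Algebra k Λ] [Module.Finite k Λ]
    {P : ℕ → Type*} [∀ n, AddCommGroup (P n)] [∀ n, Module k (P n)]
    [∀ n, Module (Env k Λ) (P n)]
    [∀ n, IsScalarTower k (Env k Λ) (P n)]
    (d : ∀ n, P (n + 1) →ₗ[Env k Λ] P n) (ε : P 0 →ₗ[Env k Λ] Λ)
    (hP : IsMinimalProjectiveResolution d ε) (n : ℕ) :
    (∃ e : ∀ (X : Type w) [AddCommGroup X] [Module k X] [Module (Env k Λ) X]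
        [IsScalarTower k (Env k Λ) X] [Module.Finite k X],
        TauCohomology k Λ (n + 1) X ≃ₗ[k]
          (P (n + 1) →ₗ[Env k Λ] X) ⧸
            LinearMap.range (homDifferential (d n) X),
      ∀ (X Y : Type w)
        [AddCommGroup X] [Module k X] [Module (Env k Λ) X]
        [IsScalarTower k (Env k Λ) X] [Module.Finite k X]
        [AddCommGroup Y] [Module k Y] [Module (Env k Λ) Y]
        [IsScalarTower k (Env k Λ) Y] [Module.Finite k Y]
        (f : X →ₗ[Env k Λ] Y) (h : TauCohomology k Λ (n + 1) X)
        (φ : P (n + 1) →ₗ[Env k Λ] X), e X h = Submodule.Quotient.mk φ →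
          e Y (TauCohomology.map k Λ (n + 1) f h) =
            Submodule.Quotient.mk (f ∘ₗ φ)) ∧
    (∃ e : ∀ (X : Type w) [AddCommGroup X] [Module k X] [Module (Env k Λ) X]
        [IsScalarTower k (Env k Λ) X] [Module.Finite k X],
        TauHomology k Λ (n + 1) X ≃ₗ[k]
          LinearMap.ker (tensorDifferential (d n) X),
      ∀ (X Y : Type w)
        [AddCommGroup X] [Module k X] [Module (Env k Λ) X]
        [IsScalarTower k (Env k Λ) X] [Module.Finite k X]
        [AddCommGroup Y] [Module k Y] [Module (Env k Λ) Y]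
        [IsScalarTower k (Env k Λ) Y] [Module.Finite k Y]
        (f : X →ₗ[Env k Λ] Y) (h : TauHomology k Λ (n + 1) X),
          (e Y (TauHomology.map k Λ (n + 1) f h) :
            BalancedTensor k (Env k Λ)
              (AsRight Y) (P (n + 1))) =
            BalancedTensor.map k (Env k Λ)
              (AsRight.map f) LinearMap.id (e X h)) := by
  let M := regular k Λ
  have hfin : ∀ m, Module.Finite (Env k Λ) (P m) := hP.finite
  have hproj : ∀ m, Module.Projective (Env k Λ) (P m)
    | 0 => hP.cover_zero.projective
    | m + 1 => (hP.cover_succ m).projective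
  have : Module.Finite k (P (n + 1)) := Module.Finite.trans (Env k Λ) _
  obtain ⟨π, hs, hπ⟩ := IsMinimalProjectiveResolution.exists_transpose (M := M) hP n
  obtain ⟨m, b, c, hbc⟩ := exists_dualBasis (Env k Λ) (P (n + 1))
  refine ⟨⟨fun X _ _ _ _ _ => dualHomKDualEquiv hbc hs hπ X, ?_⟩,
    ⟨fun X _ _ _ _ _ =>
      haveI : Module.Finite k (AsRight X) := ‹Module.Finite k X›
      homKDualKDualEquiv (AsRight X) hbc hs hπ, ?_⟩⟩
  · intro X Y _ _ _ _ _ _ _ _ _ _ f h φ hφ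
    refine (dualHomKDualEquiv_eq_iff hbc hs hπ Y _ _).2 fun g => ?_
    have := (dualHomKDualEquiv_eq_iff hbc hs hπ X h _).1 hφ
    exact (this (g ∘ₗ f)).trans (homKDualEquiv_comp hbc hs hπ f g φ)
  · intro X Y _ _ _ _ _ _ _ _ _ _ f h
    have : Module.Finite k (AsRight X) := ‹Module.Finite k X›
    have : Module.Finite k (AsRight Y) := ‹Module.Finite k Y›
    exact homKDualKDualEquiv_comp hbc hs hπ (AsRight.map f) h
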